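/- For every dimension $d\ge 1$ there is a constant $C<\infty$ depending only on $d$ with the following property. Let $h:\mathbb{R}^d\to\mathbb{R}$ be of class $C^2$ with $\|\nabla h\|_\infty\le 1$, let $\Omega_+=\{(x,z)\in\mathbb{R}^d\times\mathbb{R}: z>h(x)\}$ and $\Gamma=\partial\Omega_+=\{(x,z): z=h(x)\}$, let $n=\frac{(-\nabla h,1)}{\sqrt{1+|\nabla h|^2}}$ be the unit normal to $\Gamma$ pointing into $\Omega_+$, and let $H=\nabla\cdot\frac{\nabla h}{\sqrt{1+|\nabla h|^2}}$ be the mean curvature of $\Gamma$. Assume that the excess mass and the excess surface energy $$\mathcal V=\int_{\mathbb{R}^{d+1}}\bigl|\mathbf 1_{\Omega_+}-\mathbf 1_{\mathbb{R}^d\times\{z>0\}}\bigr|\,\mathrm d\mathbf x,\qquad \mathcal E=\int_\Gamma (1-e_z\cdot n)\,\mathrm dS$$ are finite, where $e_z$ is the unit vector in the $z$-direction. Let $f:\mathbb{R}^{d+1}\to\mathbb{R}$ be a two-sided harmonic extension of $H$, i.e. a continuous function that is harmonic in $\mathbb{R}^{d+1}\setminus\Gamma$ and satisfies $f(x,h(x))=H(x)$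 for all $x\in\mathbb{R}^d$, and let $D=\int_{\mathbb{R}^{d+1}}|\nabla f|^2\,\mathrm d\mathbf x\in[0,\infty]$ be the dissipation. Then $$\mathcal E\le C\,\mathcal V^{\frac{6}{d+5}}\,D^{\frac{d+2}{d+5}}$$ (with the convention $0\cdot\infty=0$ if $\mathcal V=0$ and $D=\infty$). -/

import Mathlib

open MeasureTheory InnerProductSpace
open scoped ENNReal NNReal

noncomputable section

namespace MullinsSekerka

/-- The Euclidean space `ℝ^(d+1) = ℝ^d × ℝ`; a point is written `(x, z)`, with `x` tangential and
`z` vertical. The norm is the Euclidean one and the measure is Lebesgue measure. -/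
abbrev Ambient (d : ℕ) : Type := WithLp 2 (EuclideanSpace ℝ (Fin d) × ℝ)

/-- The unit vector in the vertical direction. -/
def ez (d : ℕ) : Ambient d := WithLp.toLp 2 (0, 1)

/-- The positive phase `{(x, z) : z > h x}` above the graph of `h`. -/
def posPhase {d : ℕ} (h : EuclideanSpace ℝ (Fin d) → ℝ) : Set (Ambient d) :=
  {p | h p.fst < p.snd}

/-- The interface: the graph `{(x, z) : z = h x}`. -/
def interface {d : ℕ} (h : EuclideanSpace ℝ (Fin d) → ℝ) : Set (Ambient d) :=
  {p | p.snd = h p.fst}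

/-- The point `(x, h x)` of the interface above `x`. -/
def lift {d : ℕ} (h : EuclideanSpace ℝ (Fin d) → ℝ) (x : EuclideanSpace ℝ (Fin d)) : Ambient d :=
  WithLp.toLp 2 (x, h x)

/-- The area element `√(1 + |∇h|²)` of the graph of `h`. -/
def areaElement {d : ℕ} (h : EuclideanSpace ℝ (Fin d) → ℝ) (x : EuclideanSpace ℝ (Fin d)) : ℝ :=
  √(1 + ‖gradient h x‖ ^ 2)

/-- The unit normal `(-∇h, 1) / √(1 + |∇h|²)` to the graph at `(x, h x)`; it is the inward normal
to the positive phase. -/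
def normal {d : ℕ} (h : EuclideanSpace ℝ (Fin d) → ℝ) (x : EuclideanSpace ℝ (Fin d)) : Ambient d :=
  (areaElement h x)⁻¹ • WithLp.toLp 2 (-gradient h x, 1)

/-- The surface measure `dS` of the graph of `h`: the image of `√(1 + |∇h|²) dx` under
`x ↦ (x, h x)`. -/
def surfaceMeasure {d : ℕ} (h : EuclideanSpace ℝ (Fin d) → ℝ) : Measure (Ambient d) :=
  (volume.withDensity fun x => ENNReal.ofReal (areaElement h x)).map (lift h)

/-- The difference `χ` of the characteristic functions of the positive phase and of the upper
half-space `{z > 0}`. -/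
def chi {d : ℕ} (h : EuclideanSpace ℝ (Fin d) → ℝ) (p : Ambient d) : ℝ :=
  (posPhase h).indicator 1 p - {q : Ambient d | 0 < q.snd}.indicator 1 p

/-- The excess mass `∫ |χ|`. -/
def excessMass {d : ℕ} (h : EuclideanSpace ℝ (Fin d) → ℝ) : ℝ≥0∞ :=
  ∫⁻ p, ‖chi h p‖ₑ

/-- The excess surface energy `∫_Γ (1 - e_z · n) dS`. The integrand is nonnegative. -/
def excessEnergy {d : ℕ} (h : EuclideanSpace ℝ (Fin d) → ℝ) : ℝ≥0∞ :=
  ∫⁻ p, ENNReal.ofReal (1 - inner ℝ (ez d) (normal h p.fst)) ∂(surfaceMeasure h)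

/-- The divergence of a vector field: the trace of its derivative. -/
def divergence {d : ℕ} (F : EuclideanSpace ℝ (Fin d) → EuclideanSpace ℝ (Fin d))
    (x : EuclideanSpace ℝ (Fin d)) : ℝ :=
  LinearMap.trace ℝ (EuclideanSpace ℝ (Fin d)) (fderiv ℝ F x : _ →ₗ[ℝ] _)

/-- The mean curvature `∇ · (∇h / √(1 + |∇h|²))` of the graph of `h` at `(x, h x)` (the sum of the
principal curvatures, positive where the positive phase is convex). -/
def meanCurvature {d : ℕ} (h : EuclideanSpace ℝ (Fin d) → ℝ) (x : EuclideanSpace ℝ (Fin d)) : ℝ :=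
  divergence (fun y => (areaElement h y)⁻¹ • gradient h y) x

/-- `f` is a potential of the graph of `h`: it is the two-sided harmonic extension of the mean
curvature, attaining its boundary values continuously from both sides. -/
structure IsPotential {d : ℕ} (h : EuclideanSpace ℝ (Fin d) → ℝ) (f : Ambient d → ℝ) : Prop where
  continuous : Continuous f
  harmonic : HarmonicOnNhd f (interface h)ᶜ
  boundary : ∀ x, f (lift h x) = meanCurvature h x

/-- The dissipation `∫ |∇f|²` over `ℝ^(d+1)`. The potential is differentiable off the interface,
which is a null set. -/
def dissipation {d : ℕ} (f : Ambient d → ℝ) : ℝ≥0∞ :=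
  ∫⁻ p, ‖gradient f p‖ₑ ^ 2

end MullinsSekerka

end

/-!
Write `A² = 𝓔`, `X = ∇h / √(1 + |∇h|²)`, so that the mean curvature is `H = div X`. Up to constants
`𝓔` is `∫ |∇h|²`, since `|∇h| ≤ 1`, and `𝓥 = ∫ |h|`. Integrating by parts,
`𝓔 ≤ ∫ X · ∇h = -∫ H h ≤ ∫ |H| |h|` (`excessEnergy_le_lintegral_meanCurvature_mul`).

Fix a length scale `r` and let `u_r` be the average of `u` against a smooth density supported in the
ball of radius `r`. Three estimates bound `∫ |H| |h| ≤ ∫ |H - H_r| |h| + ∫ |H_r| |h|`.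

* `‖H - H_r‖₂² ≲ r D`. It suffices to bound `H - H(· - y)` in `L²` for `|y| ≤ r`. The points
  `(x, h x)` and `(x - y, h (x - y))` are joined through a point at height `r` above the graph over
  `x - y / 2`; along the two legs `f` is differentiable, and integrating `|∇f|²` over all these legs
  costs a factor `r` because the shears involved preserve volume
  (`lintegral_meanCurvature_sub_translate_sq_le`). Of harmonicity, only differentiability of `f`
  off the interface enters.
* `‖H_r‖_∞ ≲ r ^ (-(d + 2) / 2) A`, by moving the divergence to the averaging kernel and the
  Cauchy-Schwarz inequality (`enorm_average_divergence_sq_le`).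
* `‖h‖₂² ≲ r² A² + r ^ (-d) 𝓥²`, from `‖h - h_r‖₂ ≤ r ‖∇h‖₂` and `‖h_r‖_∞ ≲ r ^ (-d) 𝓥`
  (`lintegral_enorm_sq_le_of_close`).

Together, `A² ≲ Q A + Q B + A B` with `Q = r ^ (3 / 2) D ^ (1 / 2)`, `B = r ^ (-(d + 2) / 2) 𝓥`,
hence `𝓔 ≲ r³ D + r ^ (-(d + 2)) 𝓥²` for every `r > 0` (`exists_excessEnergy_le_add_mul`).
Balancing the two terms in `r` gives the claim (`le_rpow_mul_rpow_of_forall_scale`).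
-/

namespace MullinsSekerka

/-! ### Cauchy-Schwarz, translations and averages -/

theorem sq_lintegral_mul_le {α : Type*} [MeasurableSpace α] (μ : Measure α) {f g : α → ℝ≥0∞}
    (hf : AEMeasurable f μ) (hg : AEMeasurable g μ) :
    (∫⁻ x, f x * g x ∂μ) ^ 2 ≤ (∫⁻ x, f x ^ 2 ∂μ) * ∫⁻ x, g x ^ 2 ∂μ := by
  have h := ENNReal.lintegral_mul_le_Lp_mul_Lq μ Real.HolderConjugate.two_two hf hg
  have h2 : ∀ a : ℝ≥0∞, (a ^ (1 / 2 : ℝ)) ^ 2 = a := fun a => by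
    rw [← ENNReal.rpow_natCast, ← ENNReal.rpow_mul]; norm_num
  calc _ ≤ _ := pow_le_pow_left' h 2
    _ = _ := by
      rw [mul_pow, h2, h2]
      simp only [← ENNReal.rpow_natCast]; norm_num

theorem sq_lintegral_le {α : Type*} [MeasurableSpace α] (μ : Measure α) {f : α → ℝ≥0∞}
    (hf : AEMeasurable f μ) :
    (∫⁻ x, f x ∂μ) ^ 2 ≤ μ Set.univ * ∫⁻ x, f x ^ 2 ∂μ := by
  simpa using sq_lintegral_mul_le μ (f := fun _ => 1) aemeasurable_const hf

/-- Nothing is assumed on the derivative near the endpoints: if it is not integrable there, the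
right-hand side is infinite. -/
theorem enorm_sub_sq_le_lintegral_deriv {F : ℝ → ℝ} {r : ℝ} (hr : 0 ≤ r) (hF : Continuous F)
    (hd : ∀ s ∈ Set.Ioo 0 r, DifferentiableAt ℝ F s) :
    ‖F r - F 0‖ₑ ^ 2 ≤ ENNReal.ofReal r * ∫⁻ s in Set.Ioo 0 r, ‖deriv F s‖ₑ ^ 2 := by
  have key : ‖F r - F 0‖ₑ ≤ ∫⁻ s in Set.Ioo 0 r, ‖deriv F s‖ₑ := by
    by_cases hfin : ∫⁻ s in Set.Ioo 0 r, ‖deriv F s‖ₑ = ∞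
    · simp [hfin]
    have hint : IntegrableOn (deriv F) (Set.Ioo 0 r) :=
      ⟨(measurable_deriv F).aestronglyMeasurable, lt_top_iff_ne_top.2 hfin⟩
    have hI : IntervalIntegrable (deriv F) volume 0 r :=
      (intervalIntegrable_iff_integrableOn_Ioo_of_le hr).2 hint
    rw [← intervalIntegral.integral_eq_sub_of_hasDerivAt_of_le hr hF.continuousOn
      (fun s hs => (hd s hs).hasDerivAt) hI, intervalIntegral.integral_of_le hr,
      integral_Ioc_eq_integral_Ioo]
    exact enorm_integral_le_lintegral_enorm _
  calc _ ≤ _ := pow_le_pow_left' key 2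
    _ ≤ _ := sq_lintegral_le _ (measurable_deriv F).enorm.aemeasurable
    _ = _ := by simp

section Averages

variable {E : Type*} [NormedAddCommGroup E] [InnerProductSpace ℝ E] [FiniteDimensional ℝ E]
  [MeasurableSpace E] [BorelSpace E]

theorem measurable_gradient (f : E → ℝ) : Measurable (gradient f) :=
  (toDual ℝ E).symm.continuous.measurable.comp (measurable_fderiv ℝ f)

theorem enorm_inner_le {E : Type*} [NormedAddCommGroup E] [InnerProductSpace ℝ E] (a b : E) :
    ‖inner ℝ a b‖ₑ ≤ ‖a‖ₑ * ‖b‖ₑ := by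
  rw [← ofReal_norm, ← ofReal_norm, ← ofReal_norm, ← ENNReal.ofReal_mul (norm_nonneg _)]
  exact ENNReal.ofReal_le_ofReal (norm_inner_le_norm _ _)

theorem enorm_add_sq_le (a b : ℝ) :
    ‖a + b‖ₑ ^ 2 ≤ 2 * (‖a‖ₑ ^ 2 + ‖b‖ₑ ^ 2) := by
  calc _ ≤ _ := pow_le_pow_left' (enorm_add_le a b) 2
    _ ≤ _ := by
      have := ENNReal.rpow_add_le_mul_rpow_add_rpow ‖a‖ₑ ‖b‖ₑ (p := 2) (by norm_num)
      norm_num at this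
      exact_mod_cast this

theorem lintegral_enorm_sub_translate_sq_le {u : E → ℝ} (hu : ContDiff ℝ 1 u) (y : E) :
    ∫⁻ x, ‖u x - u (x - y)‖ₑ ^ 2 ≤ ‖y‖ₑ ^ 2 * ∫⁻ x, ‖gradient u x‖ₑ ^ 2 := by
  have hud := hu.differentiable one_ne_zero
  have hm := measurable_gradient u
  have pt : ∀ x, ‖u x - u (x - y)‖ₑ ^ 2 ≤
      ∫⁻ s in Set.Ioo (0 : ℝ) 1, ‖y‖ₑ ^ 2 * ‖gradient u (x - y + s • y)‖ₑ ^ 2 := by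
    intro x
    have hder : ∀ s : ℝ, HasDerivAt (fun s : ℝ => u (x - y + s • y))
        (fderiv ℝ u (x - y + s • y) y) s := by
      intro s
      have h1 : HasDerivAt (fun s : ℝ => x - y + s • y) y s := by
        simpa using ((hasDerivAt_id s).smul_const y).const_add (x - y)
      exact (hud _).hasFDerivAt.comp_hasDerivAt s h1
    have := enorm_sub_sq_le_lintegral_deriv (F := fun s : ℝ => u (x - y + s • y)) zero_le_one
      (hu.continuous.comp (by fun_prop)) (fun s _ => (hder s).differentiableAt)
    simp only [one_smul, sub_add_cancel, zero_smul, add_zero, ENNReal.ofReal_one, one_mul] at this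
    refine this.trans (lintegral_mono fun s => ?_)
    rw [(hder s).deriv, ← inner_gradient_left, ← mul_pow, mul_comm]
    gcongr
    exact enorm_inner_le _ _
  have hmeas : Measurable (fun p : E × ℝ =>
      ‖y‖ₑ ^ 2 * ‖gradient u (p.1 - y + p.2 • y)‖ₑ ^ 2) := by
    have : Measurable fun p : E × ℝ => p.1 - y + p.2 • y := by fun_prop
    have := (hm.comp this).enorm
    fun_prop
  calc _ ≤ ∫⁻ x, ∫⁻ s in Set.Ioo (0 : ℝ) 1, ‖y‖ₑ ^ 2 * ‖gradient u (x - y + s • y)‖ₑ ^ 2 :=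
        lintegral_mono pt
    _ = ∫⁻ s in Set.Ioo (0 : ℝ) 1, ∫⁻ x, ‖y‖ₑ ^ 2 * ‖gradient u (x - y + s • y)‖ₑ ^ 2 :=
        lintegral_lintegral_swap hmeas.aemeasurable
    _ = ∫⁻ s in Set.Ioo (0 : ℝ) 1, ‖y‖ₑ ^ 2 * ∫⁻ x, ‖gradient u x‖ₑ ^ 2 := by
        refine lintegral_congr fun s => ?_
        rw [lintegral_const_mul' _ _ (by simp)]
        congr 1
        rw [← lintegral_add_right_eq_self (fun x => ‖gradient u x‖ₑ ^ 2) (-y + s • y)]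
        simp only [sub_eq_add_neg, add_assoc]
    _ = _ := by simp

/-- Jensen's inequality: the distance in `L²` from `u` to its average against a probability density
is at most the largest distance to the translates that are averaged. -/
theorem lintegral_enorm_sub_average_sq_le {u φ : E → ℝ} (hu : Continuous u) (hφ : Continuous φ)
    (hφ0 : ∀ y, 0 ≤ φ y) {r : ℝ} (hφs : ∀ y, r < ‖y‖ → φ y = 0)
    (hφ1 : ∫ y, φ y = 1) {B : ℝ≥0∞}
    (hB : ∀ y, ‖y‖ ≤ r → ∫⁻ x, ‖u x - u (x - y)‖ₑ ^ 2 ≤ B) :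
    ∫⁻ x, ‖u x - ∫ y, φ y * u (x - y)‖ₑ ^ 2 ≤ B := by
  have hcs : HasCompactSupport φ := by
    refine HasCompactSupport.of_support_subset_isCompact (isCompact_closedBall 0 r) fun y hy => ?_
    by_contra hc
    exact hy (hφs y (by simpa using hc))
  have hφi : Integrable φ := hφ.integrable_of_hasCompactSupport hcs
  have hmass : ∫⁻ y, ENNReal.ofReal (φ y) = 1 := by
    rw [← ofReal_integral_eq_lintegral_ofReal hφi (Filter.Eventually.of_forall hφ0), hφ1,
      ENNReal.ofReal_one]
  have hφm : Measurable fun y => ENNReal.ofReal (φ y) := hφ.measurable.ennreal_ofReal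
  set ν : Measure E := volume.withDensity fun y => ENNReal.ofReal (φ y) with hν
  have pt : ∀ x, ‖u x - ∫ y, φ y * u (x - y)‖ₑ ^ 2 ≤
      ∫⁻ y, ENNReal.ofReal (φ y) * ‖u x - u (x - y)‖ₑ ^ 2 := by
    intro x
    have h1 : Integrable fun y => φ y * u (x - y) :=
      (by fun_prop : Continuous fun y => φ y * u (x - y)).integrable_of_hasCompactSupport
        hcs.mul_right
    have h2 : u x - ∫ y, φ y * u (x - y) = ∫ y, φ y * (u x - u (x - y)) := by
      simp only [mul_sub]
      rw [integral_sub (hφi.mul_const _) h1, integral_mul_const, hφ1, one_mul]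
    have hum : Measurable fun y => ‖u x - u (x - y)‖ₑ :=
      (by fun_prop : Continuous fun y => u x - u (x - y)).measurable.enorm
    have h3 : ‖u x - ∫ y, φ y * u (x - y)‖ₑ ≤ ∫⁻ y, ‖u x - u (x - y)‖ₑ ∂ν := by
      rw [h2, hν, lintegral_withDensity_eq_lintegral_mul _ hφm hum]
      refine (enorm_integral_le_lintegral_enorm _).trans_eq (lintegral_congr fun y => ?_)
      simp [enorm_mul, Real.enorm_of_nonneg (hφ0 y)]
    calc _ ≤ _ := pow_le_pow_left' h3 2
      _ ≤ _ := sq_lintegral_le ν hum.aemeasurable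
      _ = _ := by
        rw [hν, withDensity_apply _ MeasurableSet.univ, Measure.restrict_univ, hmass, one_mul,
          lintegral_withDensity_eq_lintegral_mul _ hφm (hum.pow_const 2)]
        rfl
  have hmeas : Measurable (fun p : E × E =>
      ENNReal.ofReal (φ p.2) * ‖u p.1 - u (p.1 - p.2)‖ₑ ^ 2) := by
    have h1 : Measurable fun p : E × E => ENNReal.ofReal (φ p.2) := hφm.comp measurable_snd
    have h2 : Measurable fun p : E × E => ‖u p.1 - u (p.1 - p.2)‖ₑ :=
      (by fun_prop : Continuous fun p : E × E => u p.1 - u (p.1 - p.2)).measurable.enorm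
    exact h1.mul (h2.pow_const 2)
  calc _ ≤ ∫⁻ x, ∫⁻ y, ENNReal.ofReal (φ y) * ‖u x - u (x - y)‖ₑ ^ 2 := lintegral_mono pt
    _ = ∫⁻ y, ∫⁻ x, ENNReal.ofReal (φ y) * ‖u x - u (x - y)‖ₑ ^ 2 :=
        lintegral_lintegral_swap hmeas.aemeasurable
    _ ≤ ∫⁻ y, ENNReal.ofReal (φ y) * B := by
        refine lintegral_mono fun y => ?_
        rw [lintegral_const_mul' _ _ (by simp)]
        by_cases hy : ‖y‖ ≤ r
        · gcongr; exact hB y hy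
        · simp [hφs y (not_le.1 hy)]
    _ = B := by rw [lintegral_mul_const _ hφm, hmass, one_mul]

end Averages

/-! ### The geometry of the graph and the potential above it -/

variable {d : ℕ}

/-- The vector field `∇h / √(1 + |∇h|²)`, whose divergence is the mean curvature. -/
noncomputable def slopeField (h : EuclideanSpace ℝ (Fin d) → ℝ) (x : EuclideanSpace ℝ (Fin d)) :
    EuclideanSpace ℝ (Fin d) :=
  (areaElement h x)⁻¹ • gradient h x

section Graph

variable {h : EuclideanSpace ℝ (Fin d) → ℝ}

theorem sq_areaElement (x : EuclideanSpace ℝ (Fin d)) :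
    areaElement h x ^ 2 = 1 + ‖gradient h x‖ ^ 2 :=
  Real.sq_sqrt (by positivity)

theorem one_le_areaElement (x : EuclideanSpace ℝ (Fin d)) : 1 ≤ areaElement h x :=
  Real.one_le_sqrt.2 (by nlinarith [sq_nonneg ‖gradient h x‖])

theorem contDiff_gradient (hh : ContDiff ℝ 2 h) : ContDiff ℝ 1 (gradient h) :=
  (toDual ℝ (EuclideanSpace ℝ (Fin d))).symm.contDiff.comp
    (hh.fderiv_right (m := 1) (by norm_num))

theorem contDiff_slopeField (hh : ContDiff ℝ 2 h) : ContDiff ℝ 1 (slopeField h) := by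
  have hg := contDiff_gradient hh
  have ha : ContDiff ℝ 1 (areaElement h) :=
    (contDiff_const.add (hg.norm_sq ℝ)).sqrt fun x => by positivity
  exact (ha.inv fun x => (zero_lt_one.trans_le (one_le_areaElement x)).ne').smul hg

theorem norm_slopeField_le (x : EuclideanSpace ℝ (Fin d)) :
    ‖slopeField h x‖ ≤ ‖gradient h x‖ := by
  have h1 := one_le_areaElement (h := h) x
  rw [slopeField, norm_smul, norm_inv, Real.norm_of_nonneg (by linarith)]
  exact mul_le_of_le_one_left (norm_nonneg _) (inv_le_one_of_one_le₀ h1)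

/-- The energy density is at most `∇h · ∇h / √(1 + |∇h|²)`. -/
theorem areaElement_sub_one_le_inner (x : EuclideanSpace ℝ (Fin d)) :
    areaElement h x - 1 ≤ fderiv ℝ h x (slopeField h x) := by
  have h1 := one_le_areaElement (h := h) x
  have h2 := sq_areaElement (h := h) x
  rw [← inner_gradient_left, slopeField, inner_smul_right, real_inner_self_eq_norm_sq,
    ← div_eq_inv_mul, le_div_iff₀ (by linarith)]
  nlinarith

/-- The converse comparison; the constant is `√2 + 1 ≤ 3`. -/
theorem norm_gradient_sq_le (hL : ∀ x, ‖gradient h x‖ ≤ 1) (x : EuclideanSpace ℝ (Fin d)) :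
    ‖gradient h x‖ ^ 2 ≤ 3 * (areaElement h x - 1) := by
  have h1 := one_le_areaElement (h := h) x
  have h2 := sq_areaElement (h := h) x
  have h3 := hL x
  have h4 : ‖gradient h x‖ ^ 2 ≤ 1 := by nlinarith [norm_nonneg (gradient h x)]
  nlinarith

theorem measurable_areaElement : Measurable (areaElement h) :=
  (Measurable.const_add ((measurable_gradient h).norm.pow_const 2) 1).sqrt

theorem continuous_lift (hh : Continuous h) : Continuous (lift h) :=
  (WithLp.prod_continuous_toLp 2 _ _).comp (by fun_prop)

theorem excessEnergy_eq (hh : Continuous h) :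
    excessEnergy h = ∫⁻ x, ENNReal.ofReal (areaElement h x - 1) := by
  have hn : ∀ x, inner ℝ (ez d) (normal h x) = (areaElement h x)⁻¹ := fun x => by
    simp [normal, ez, inner_smul_right, WithLp.prod_inner_apply]
  have hfst : Measurable fun p : Ambient d => p.fst :=
    (WithLp.prod_continuous_ofLp 2 _ _).fst.measurable
  have hm : Measurable fun p : Ambient d => ENNReal.ofReal (1 - (areaElement h p.fst)⁻¹) :=
    ((measurable_areaElement.comp hfst).inv.const_sub 1).ennreal_ofReal
  simp only [excessEnergy, surfaceMeasure, hn]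
  rw [lintegral_map hm (continuous_lift hh).measurable,
    lintegral_withDensity_eq_lintegral_mul _ measurable_areaElement.ennreal_ofReal
      (show Measurable fun x => ENNReal.ofReal (1 - (areaElement h (lift h x).fst)⁻¹) from
        hm.comp (continuous_lift hh).measurable)]
  refine lintegral_congr fun x => ?_
  have h1 := one_le_areaElement (h := h) x
  simp only [Pi.mul_apply, lift]
  rw [← ENNReal.ofReal_mul (by linarith)]
  congr 1
  rw [mul_sub, mul_one]
  exact congrArg _ (mul_inv_cancel₀ (by positivity))

theorem lintegral_ambient {g : Ambient d → ℝ≥0∞} (hg : Measurable g) :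
    ∫⁻ p, g p = ∫⁻ x, ∫⁻ z, g (WithLp.toLp 2 (x, z)) := by
  have hmp := WithLp.volume_preserving_toLp (EuclideanSpace ℝ (Fin d)) ℝ
  rw [← hmp.lintegral_comp hg, Measure.volume_eq_prod,
    lintegral_prod (fun q => g (WithLp.toLp 2 q)) (hg.comp hmp.measurable).aemeasurable]

theorem measurable_chi (hh : Continuous h) : Measurable (chi h) := by
  have hc := WithLp.prod_continuous_ofLp 2 (EuclideanSpace ℝ (Fin d)) ℝ
  have h1 : IsOpen (posPhase h) := isOpen_lt (hh.comp hc.fst) hc.snd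
  have h2 : IsOpen {q : Ambient d | 0 < q.snd} := isOpen_lt continuous_const hc.snd
  exact (measurable_one.indicator h1.measurableSet).sub
    (measurable_one.indicator h2.measurableSet)

theorem excessMass_eq (hh : Continuous h) : excessMass h = ∫⁻ x, ‖h x‖ₑ := by
  classical
  rw [excessMass, lintegral_ambient (measurable_chi hh).enorm]
  refine lintegral_congr fun x => ?_
  have hs : (fun z : ℝ => ‖chi h (WithLp.toLp 2 (x, z))‖ₑ) =
      (Set.uIoc 0 (h x)).indicator 1 := by
    funext z
    have hchi : chi h (WithLp.toLp 2 (x, z)) =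
        (if h x < z then 1 else 0) - (if 0 < z then 1 else 0) := by
      rw [chi, Set.indicator_apply, Set.indicator_apply]
      exact congrArg₂ (· - ·) (if_congr Iff.rfl rfl rfl) (if_congr Iff.rfl rfl rfl)
    have hu : (Set.uIoc 0 (h x)).indicator (1 : ℝ → ℝ≥0∞) z =
        if 0 < z ∧ z ≤ h x ∨ h x < z ∧ z ≤ 0 then 1 else 0 := by
      rw [Set.indicator_apply]
      exact if_congr Set.mem_uIoc rfl rfl
    rw [hchi, hu]
    rcases lt_or_ge (h x) z with a | a <;> rcases lt_or_ge 0 z with b | b <;>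
      simp [a, b, not_lt.2, not_le.2]
  rw [hs, lintegral_indicator_one measurableSet_uIoc, Real.volume_uIoc, sub_zero,
    Real.enorm_eq_ofReal_abs]

theorem lintegral_shear (h : EuclideanSpace ℝ (Fin d) → ℝ) {g : Ambient d → ℝ≥0∞}
    (hg : Measurable g) :
    ∫⁻ x, ∫⁻ s, g (WithLp.toLp 2 (x, h x + s)) = ∫⁻ p, g p := by
  rw [lintegral_ambient hg]
  refine lintegral_congr fun x => ?_
  exact lintegral_add_left_eq_self (fun z => g (WithLp.toLp 2 (x, z))) (h x)

theorem hasDerivAt_toLp_prodMk {U V : Type*} [NormedAddCommGroup U] [NormedSpace ℝ U]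
    [NormedAddCommGroup V] [NormedSpace ℝ V] {a : ℝ → U} {b : ℝ → V} {a' : U} {b' : V} {s : ℝ}
    (ha : HasDerivAt a a' s) (hb : HasDerivAt b b' s) :
    HasDerivAt (fun s => WithLp.toLp 2 (a s, b s)) (WithLp.toLp 2 (a', b')) s :=
  (WithLp.prodContinuousLinearEquiv 2 ℝ U V).symm.toContinuousLinearMap.hasFDerivAt
    |>.comp_hasDerivAt s (ha.prodMk hb)

/-- Following the potential from the interface along the curve `s ↦ (x + s v, h (x + s v) + s)`,
which leaves the interface for `s > 0`: the change up to height `r` is controlled in `L²` by the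
dissipation. The velocity `(v, ∇h · v + 1)` has norm at most `2`, as `|v| ≤ 1 / 2` and `|∇h| ≤ 1`. -/
theorem lintegral_enorm_lift_sub_shift_sq_le (hh : ContDiff ℝ 2 h) (hL : ∀ x, ‖gradient h x‖ ≤ 1)
    {f : Ambient d → ℝ} (hf : IsPotential h f) {r : ℝ} (hr : 0 ≤ r)
    {v : EuclideanSpace ℝ (Fin d)} (hv : ‖v‖ ≤ 1 / 2) :
    ∫⁻ x, ‖f (WithLp.toLp 2 (x + r • v, h (x + r • v) + r)) - f (lift h x)‖ₑ ^ 2 ≤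
      4 * ENNReal.ofReal r * dissipation f := by
  have hhc := hh.continuous
  have hm := measurable_gradient f
  let γ : EuclideanSpace ℝ (Fin d) → ℝ → Ambient d :=
    fun x s => WithLp.toLp 2 (x + s • v, h (x + s • v) + s)
  have hγ : Continuous fun p : EuclideanSpace ℝ (Fin d) × ℝ => γ p.1 p.2 :=
    (WithLp.prod_continuous_toLp 2 _ _).comp (by fun_prop)
  have pt : ∀ x, ‖f (γ x r) - f (lift h x)‖ₑ ^ 2 ≤
      ENNReal.ofReal r * ∫⁻ s in Set.Ioo (0 : ℝ) r, 4 * ‖gradient f (γ x s)‖ₑ ^ 2 := by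
    intro x
    have hder : ∀ s ∈ Set.Ioo 0 r, ∃ w : Ambient d, ‖w‖ ≤ 2 ∧
        HasDerivAt (fun s => f (γ x s)) (fderiv ℝ f (γ x s) w) s := by
      intro s hs
      have h1 : HasDerivAt (fun s : ℝ => x + s • v) v s := by
        simpa using ((hasDerivAt_id s).smul_const v).const_add x
      have h2 : HasDerivAt (fun s : ℝ => h (x + s • v) + s)
          (fderiv ℝ h (x + s • v) v + 1) s :=
        ((hh.differentiable two_ne_zero _).hasFDerivAt.comp_hasDerivAt s h1).add
          (hasDerivAt_id s)
      have h3 := hasDerivAt_toLp_prodMk h1 h2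
      have hne : γ x s ∈ (interface h)ᶜ := by
        intro hc
        have hc' : h (x + s • v) + s = h (x + s • v) := hc
        linarith [hs.1]
      have h5 := ((hf.harmonic (γ x s) hne).1.differentiableAt two_ne_zero).hasFDerivAt
      refine ⟨_, ?_, h5.comp_hasDerivAt s h3⟩
      · have h4 : |fderiv ℝ h (x + s • v) v| ≤ 1 / 2 := by
          rw [← inner_gradient_left]
          refine (abs_real_inner_le_norm _ _).trans ?_
          nlinarith [hL (x + s • v), norm_nonneg (gradient h (x + s • v)), norm_nonneg v]
        rw [WithLp.prod_norm_eq_of_L2, Real.sqrt_le_left (by norm_num)]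
        change ‖v‖ ^ 2 + ‖fderiv ℝ h (x + s • v) v + 1‖ ^ 2 ≤ 2 ^ 2
        simp only [Real.norm_eq_abs, sq_abs]
        nlinarith [abs_le.1 h4, norm_nonneg v]
    have := enorm_sub_sq_le_lintegral_deriv (F := fun s => f (γ x s)) hr
      (hf.continuous.comp (hγ.comp (by fun_prop : Continuous fun s : ℝ => (x, s))))
      (fun s hs => (hder s hs).choose_spec.2.differentiableAt)
    have h0 : γ x 0 = lift h x := by simp [γ, lift]
    rw [h0] at this
    refine this.trans (mul_le_mul_right (setLIntegral_mono' measurableSet_Ioo fun s hs => ?_) _)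
    obtain ⟨w, hw, hdw⟩ := hder s hs
    rw [hdw.deriv, ← inner_gradient_left, show (4 : ℝ≥0∞) = 2 ^ 2 by norm_num, ← mul_pow]
    gcongr
    refine (enorm_inner_le _ _).trans ?_
    rw [mul_comm]
    gcongr
    rw [← ofReal_norm]
    exact (ENNReal.ofReal_le_ofReal hw).trans_eq (by simp)
  have hmeas : Measurable fun p : EuclideanSpace ℝ (Fin d) × ℝ =>
      ‖gradient f (γ p.1 p.2)‖ₑ ^ 2 := (hm.comp hγ.measurable).enorm.pow_const 2
  have hmeas' : Measurable fun p : EuclideanSpace ℝ (Fin d) × ℝ =>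
      ‖gradient f (WithLp.toLp 2 (p.1, h p.1 + p.2))‖ₑ ^ 2 :=
    (hm.comp ((WithLp.prod_continuous_toLp 2 _ _).comp
      (by fun_prop : Continuous fun p : EuclideanSpace ℝ (Fin d) × ℝ =>
        (p.1, h p.1 + p.2))).measurable).enorm.pow_const 2
  calc _ ≤ ∫⁻ x, ENNReal.ofReal r * ∫⁻ s, 4 * ‖gradient f (γ x s)‖ₑ ^ 2 :=
        lintegral_mono fun x => (pt x).trans (mul_le_mul_right (setLIntegral_le_lintegral _ _) _)
    _ = 4 * ENNReal.ofReal r * ∫⁻ x, ∫⁻ s, ‖gradient f (γ x s)‖ₑ ^ 2 := by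
        simp only [lintegral_const_mul' 4 _ (by norm_num)]
        simp only [← mul_assoc]
        rw [lintegral_const_mul' _ _ (by finiteness), mul_comm (4 : ℝ≥0∞)]
    _ = 4 * ENNReal.ofReal r *
          ∫⁻ s, ∫⁻ x, ‖gradient f (WithLp.toLp 2 (x, h x + s))‖ₑ ^ 2 := by
        rw [lintegral_lintegral_swap hmeas.aemeasurable]
        congr 1
        refine lintegral_congr fun s => ?_
        exact lintegral_add_right_eq_self
          (fun x => ‖gradient f (WithLp.toLp 2 (x, h x + s))‖ₑ ^ 2) (s • v)
    _ ≤ _ := by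
        rw [← lintegral_lintegral_swap hmeas'.aemeasurable]
        rw [lintegral_shear h (g := fun p => ‖gradient f p‖ₑ ^ 2) (hm.enorm.pow_const 2),
          dissipation]

/-- The curvature, as the trace of `f`, is `1/2`-Hölder under translation in `L²`: the two curves
starting at `x` and `x - y` meet at height `r` above the graph over `x - y / 2`. -/
theorem lintegral_meanCurvature_sub_translate_sq_le (hh : ContDiff ℝ 2 h)
    (hL : ∀ x, ‖gradient h x‖ ≤ 1) {f : Ambient d → ℝ} (hf : IsPotential h f) {r : ℝ}
    (hr : 0 < r) {y : EuclideanSpace ℝ (Fin d)} (hy : ‖y‖ ≤ r) :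
    ∫⁻ x, ‖meanCurvature h x - meanCurvature h (x - y)‖ₑ ^ 2 ≤
      16 * ENNReal.ofReal r * dissipation f := by
  have hv : ‖(2 * r)⁻¹ • y‖ ≤ 1 / 2 := by
    rw [norm_smul, norm_inv, Real.norm_of_nonneg (by positivity), inv_mul_le_iff₀ (by positivity)]
    linarith
  have h1 := lintegral_enorm_lift_sub_shift_sq_le hh hL hf hr.le hv
  have h2 := lintegral_enorm_lift_sub_shift_sq_le hh hL hf hr.le (v := -((2 * r)⁻¹ • y))
    (by rwa [norm_neg])
  have hrv : r • (2 * r)⁻¹ • y = (1 / 2 : ℝ) • y := by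
    rw [smul_smul]; congr 1; field_simp
  rw [hrv] at h1
  rw [smul_neg, hrv] at h2
  rw [← lintegral_sub_right_eq_self _ y] at h1
  let m : EuclideanSpace ℝ (Fin d) → ℝ := fun x =>
    f (WithLp.toLp 2 (x - (1 / 2 : ℝ) • y, h (x - (1 / 2 : ℝ) • y) + r))
  have hm1 : ∀ x, f (WithLp.toLp 2 (x - y + (1 / 2 : ℝ) • y, h (x - y + (1 / 2 : ℝ) • y) + r)) =
      m x := fun x => by
    have : x - y + (1 / 2 : ℝ) • y = x - (1 / 2 : ℝ) • y := by module
    simp only [this, m]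
  simp only [hm1, hf.boundary] at h1
  simp only [← sub_eq_add_neg, hf.boundary] at h2
  have hHc : Continuous (meanCurvature h) := by
    have : meanCurvature h = f ∘ lift h := funext fun x => (hf.boundary x).symm
    rw [this]
    exact hf.continuous.comp (continuous_lift hh.continuous)
  have hmc : Continuous m := hf.continuous.comp ((WithLp.prod_continuous_toLp 2 _ _).comp
    (by have := hh.continuous; fun_prop))
  calc _ ≤ ∫⁻ x, 2 * (‖m x - meanCurvature h x‖ₑ ^ 2 +
          ‖m x - meanCurvature h (x - y)‖ₑ ^ 2) := by
        refine lintegral_mono fun x => ?_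
        have := enorm_add_sq_le (-(m x - meanCurvature h x)) (m x - meanCurvature h (x - y))
        rw [enorm_neg] at this
        convert this using 3
        ring
    _ = 2 * ((∫⁻ x, ‖m x - meanCurvature h x‖ₑ ^ 2) +
          ∫⁻ x, ‖m x - meanCurvature h (x - y)‖ₑ ^ 2) := by
        rw [lintegral_const_mul' _ _ (by norm_num), lintegral_add_left]
        exact (hmc.sub hHc).measurable.enorm.pow_const 2
    _ ≤ 2 * (4 * ENNReal.ofReal r * dissipation f + 4 * ENNReal.ofReal r * dissipation f) := by
        gcongr
    _ = _ := by ring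

end Graph

/-- Integration by parts against a compactly supported function. -/
theorem integral_mul_divergence {X : EuclideanSpace ℝ (Fin d) → EuclideanSpace ℝ (Fin d)}
    (hX : ContDiff ℝ 1 X) {g : EuclideanSpace ℝ (Fin d) → ℝ} (hg : ContDiff ℝ 1 g)
    (hgs : HasCompactSupport g) :
    ∫ x, g x * divergence X x = -∫ x, fderiv ℝ g x (X x) := by
  let b := EuclideanSpace.basisFun (Fin d) ℝ
  have hXi : ∀ i, ContDiff ℝ 1 fun x => X x i := fun i => by fun_prop
  have hfX : ∀ i, Continuous fun x => fderiv ℝ (fun y => X y i) x (b i) := fun i =>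
    ((hXi i).continuous_fderiv one_ne_zero).clm_apply continuous_const
  have hfg : ∀ i, Continuous fun x => fderiv ℝ g x (b i) := fun i =>
    (hg.continuous_fderiv one_ne_zero).clm_apply continuous_const
  have hgd : ∀ i, HasCompactSupport fun x => fderiv ℝ g x (b i) := fun i =>
    hgs.fderiv_apply ℝ (b i)
  have i1 : ∀ i, Integrable fun x => g x * fderiv ℝ (fun y => X y i) x (b i) := fun i =>
    (hg.continuous.mul (hfX i)).integrable_of_hasCompactSupport hgs.mul_right
  have i2 : ∀ i, Integrable fun x => fderiv ℝ g x (b i) * X x i := fun i =>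
    ((hfg i).mul (hXi i).continuous).integrable_of_hasCompactSupport (hgd i).mul_right
  have i3 : ∀ i, Integrable fun x => g x * X x i := fun i =>
    (hg.continuous.mul (hXi i).continuous).integrable_of_hasCompactSupport hgs.mul_right
  have hdiv : ∀ x, divergence X x = ∑ i, fderiv ℝ (fun y => X y i) x (b i) := fun x => by
    rw [divergence, LinearMap.trace_eq_sum_inner _ b]
    refine Finset.sum_congr rfl fun i _ => ?_
    have h1 : HasFDerivAt (fun y => X y i)
        ((EuclideanSpace.proj i : EuclideanSpace ℝ (Fin d) →L[ℝ] ℝ).comp (fderiv ℝ X x)) x :=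
      (EuclideanSpace.proj i : EuclideanSpace ℝ (Fin d) →L[ℝ] ℝ).hasFDerivAt.comp x
        (hX.differentiable one_ne_zero x).hasFDerivAt
    rw [h1.fderiv]
    simp [b, EuclideanSpace.inner_single_left]
  have hgX : ∀ x, fderiv ℝ g x (X x) = ∑ i, fderiv ℝ g x (b i) * X x i := fun x => by
    conv_lhs => rw [← b.sum_repr (X x)]
    simp [b, mul_comm]
  simp only [hdiv, hgX, Finset.mul_sum]
  rw [integral_finsetSum _ fun i _ => i1 i, integral_finsetSum _ fun i _ => i2 i,
    ← Finset.sum_neg_distrib]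
  refine Finset.sum_congr rfl fun i _ => ?_
  exact integral_mul_fderiv_eq_neg_fderiv_mul_of_integrable (i2 i) (i1 i) (i3 i)
    (fun x _ => hg.differentiable one_ne_zero x) fun x _ => (hXi i).differentiable one_ne_zero x

/-! ### Averaging kernels and cutoffs -/

section Kernel

variable {E : Type*} [NormedAddCommGroup E] [InnerProductSpace ℝ E] [FiniteDimensional ℝ E]
  [MeasurableSpace E] [BorelSpace E]

open Module in
/-- Probability densities supported in the ball of radius `r`, with the bounds that rescaling
gives for the density and for the `L²` norm of its derivative. -/
theorem exists_mollifier (E : Type*) [NormedAddCommGroup E] [InnerProductSpace ℝ E]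
    [FiniteDimensional ℝ E] [MeasurableSpace E] [BorelSpace E] :
    ∃ M K : ℝ, 0 ≤ M ∧ 0 ≤ K ∧ ∀ r : ℝ, 0 < r → ∃ φ : E → ℝ, ContDiff ℝ 1 φ ∧ (∀ y, 0 ≤ φ y) ∧
      (∀ y, r < ‖y‖ → φ y = 0) ∧ ∫ y, φ y = 1 ∧ (∀ y, φ y ≤ M / r ^ finrank ℝ E) ∧
      ∫⁻ y, ‖fderiv ℝ φ y‖ₑ ^ 2 ≤ ENNReal.ofReal (K / r ^ (finrank ℝ E + 2)) := by
  obtain ⟨ψ, hψ, hψs, hψ0, hψ1, hψi⟩ : ∃ ψ : E → ℝ, ContDiff ℝ 1 ψ ∧ HasCompactSupport ψ ∧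
      (∀ y, 0 ≤ ψ y) ∧ Function.support ψ = Metric.ball 0 1 ∧ ∫ y, ψ y = 1 := by
    let b : ContDiffBump (0 : E) := ⟨1 / 2, 1, by norm_num, by norm_num⟩
    exact ⟨b.normed volume, b.contDiff_normed, b.hasCompactSupport_normed, b.nonneg_normed,
      b.support_normed_eq, b.integral_normed⟩
  have hψ' : Continuous (fderiv ℝ ψ) := hψ.continuous_fderiv one_ne_zero
  obtain ⟨M, hM⟩ := hψs.exists_bound_of_continuous hψ.continuous
  refine ⟨M, ∫ y, ‖fderiv ℝ ψ y‖ ^ 2, (norm_nonneg _).trans (hM 0),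
    integral_nonneg fun _ => by positivity, fun r hr => ?_⟩
  have hrn : 0 < r ^ finrank ℝ E := by positivity
  have hc : ContDiff ℝ 1 fun y : E => ψ (r⁻¹ • y) := hψ.comp (contDiff_const_smul _)
  have hd : ∀ y, fderiv ℝ (fun y => (r ^ finrank ℝ E)⁻¹ * ψ (r⁻¹ • y)) y =
      ((r ^ finrank ℝ E)⁻¹ * r⁻¹) • fderiv ℝ ψ (r⁻¹ • y) := fun y => by
    rw [fderiv_const_mul (hc.differentiable one_ne_zero y), fderiv_comp_smul, smul_smul]
  refine ⟨fun y => (r ^ finrank ℝ E)⁻¹ * ψ (r⁻¹ • y), contDiff_const.mul hc,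
    fun y => mul_nonneg (by positivity) (hψ0 _), fun y hy => ?_, ?_, fun y => ?_, ?_⟩
  · have : r⁻¹ • y ∉ Function.support ψ := by
      rw [hψ1, mem_ball_zero_iff, norm_smul, norm_inv, Real.norm_of_nonneg hr.le,
        not_lt, le_inv_mul_iff₀ hr]
      linarith
    simp [Function.notMem_support.1 this]
  · rw [integral_const_mul, Measure.integral_comp_inv_smul_of_nonneg volume ψ hr.le,
      hψi, smul_eq_mul, mul_one, inv_mul_cancel₀ hrn.ne']
  · rw [div_eq_inv_mul]
    exact mul_le_mul_of_nonneg_left ((le_abs_self _).trans (hM _)) (by positivity)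
  · have hi : Integrable fun y : E => ‖fderiv ℝ ψ (r⁻¹ • y)‖ ^ 2 := by
      have : Integrable fun y : E => ‖fderiv ℝ ψ y‖ ^ 2 :=
        (hψ'.norm.pow 2).integrable_of_hasCompactSupport
          ((hψs.fderiv ℝ).mono fun y hy hc => hy (by simp [hc]))
      exact this.comp_smul (inv_ne_zero hr.ne')
    have he : ∀ y, ‖fderiv ℝ (fun y => (r ^ finrank ℝ E)⁻¹ * ψ (r⁻¹ • y)) y‖ₑ ^ 2 =
        ENNReal.ofReal (((r ^ finrank ℝ E)⁻¹ * r⁻¹) ^ 2 * ‖fderiv ℝ ψ (r⁻¹ • y)‖ ^ 2) := fun y => by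
      rw [hd, ← ofReal_norm, ← ENNReal.ofReal_pow (norm_nonneg _), norm_smul, mul_pow,
        Real.norm_of_nonneg (by positivity)]
    simp only [he]
    rw [← ofReal_integral_eq_lintegral_ofReal (hi.const_mul _)
      (Filter.Eventually.of_forall fun _ => by positivity), integral_const_mul,
      Measure.integral_comp_inv_smul_of_nonneg volume (fun y => ‖fderiv ℝ ψ y‖ ^ 2) hr.le,
      smul_eq_mul]
    refine ENNReal.ofReal_le_ofReal (le_of_eq ?_)
    field_simp
    ring

/-- Cutoffs equal to `1` on the ball of radius `R`, with gradient of order `1 / R`. -/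
theorem exists_cutoff (E : Type*) [NormedAddCommGroup E] [InnerProductSpace ℝ E]
    [FiniteDimensional ℝ E] :
    ∃ L : ℝ, 0 ≤ L ∧ ∀ R : ℝ, 0 < R → ∃ η : E → ℝ, ContDiff ℝ 1 η ∧ HasCompactSupport η ∧
      (∀ x, 0 ≤ η x) ∧ (∀ x, η x ≤ 1) ∧ (∀ x, ‖x‖ ≤ R → η x = 1) ∧
      ∀ x, ‖fderiv ℝ η x‖ ≤ L / R := by
  let b : ContDiffBump (0 : E) := ⟨1, 2, by norm_num, by norm_num⟩
  have hb : ContDiff ℝ 1 b := b.contDiff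
  obtain ⟨L, hL⟩ := (b.hasCompactSupport.fderiv ℝ).exists_bound_of_continuous
    (hb.continuous_fderiv one_ne_zero)
  refine ⟨L, (norm_nonneg _).trans (hL 0), fun R hR => ⟨fun x => b (R⁻¹ • x),
    hb.comp (contDiff_const_smul _), b.hasCompactSupport.comp_smul (inv_ne_zero hR.ne'),
    fun x => b.nonneg, fun x => b.le_one, fun x hx => b.one_of_mem_closedBall ?_, fun x => ?_⟩⟩
  · rw [mem_closedBall_zero_iff, norm_smul, norm_inv, Real.norm_of_nonneg hR.le]
    change R⁻¹ * ‖x‖ ≤ 1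
    rwa [inv_mul_le_iff₀ hR, mul_one]
  · rw [fderiv_comp_smul, norm_smul, norm_inv, Real.norm_of_nonneg hR.le, div_eq_inv_mul]
    gcongr
    exact hL _

theorem enorm_average_le {u φ : E → ℝ} (hφ0 : ∀ y, 0 ≤ φ y) {S : ℝ} (hS : ∀ y, φ y ≤ S)
    (x : E) : ‖∫ y, φ y * u (x - y)‖ₑ ≤ ENNReal.ofReal S * ∫⁻ y, ‖u y‖ₑ := by
  calc _ ≤ ∫⁻ y, ‖φ y * u (x - y)‖ₑ := enorm_integral_le_lintegral_enorm _
    _ ≤ ∫⁻ y, ENNReal.ofReal S * ‖u (x - y)‖ₑ := by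
        refine lintegral_mono fun y => ?_
        rw [enorm_mul, Real.enorm_of_nonneg (hφ0 y)]
        gcongr
        exact hS y
    _ = _ := by
        rw [lintegral_const_mul' _ _ (by simp), lintegral_sub_left_eq_self (fun y => ‖u y‖ₑ)]

theorem stronglyMeasurable_average {u φ : E → ℝ} (hu : Continuous u) (hφ : Continuous φ) :
    StronglyMeasurable fun x => ∫ y, φ y * u (x - y) :=
  (by fun_prop : Continuous fun p : E × E => φ p.2 * u (p.1 - p.2)).stronglyMeasurable
    |>.integral_prod_right'

/-- The pointwise bound `u² ≤ (u - m)² + 2 |m| |u|` integrated; no finiteness of `∫ u²` is needed. -/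
theorem lintegral_enorm_sq_le_of_close {u m : E → ℝ} (hu : Continuous u) (hm : Measurable m)
    {S : ℝ≥0∞} (hS : ∀ x, ‖m x‖ₑ ≤ S) :
    ∫⁻ x, ‖u x‖ₑ ^ 2 ≤ (∫⁻ x, ‖u x - m x‖ₑ ^ 2) + 2 * S * ∫⁻ x, ‖u x‖ₑ := by
  rw [← lintegral_const_mul _ hu.measurable.enorm,
    ← lintegral_add_left (show Measurable fun x => ‖u x - m x‖ₑ ^ 2 from
      (hu.measurable.sub hm).enorm.pow_const 2)]
  refine lintegral_mono fun x => ?_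
  calc ‖u x‖ₑ ^ 2 ≤ ‖u x - m x‖ₑ ^ 2 + 2 * ‖m x‖ₑ * ‖u x‖ₑ := by
        simp only [Real.enorm_eq_ofReal_abs]
        rw [← ENNReal.ofReal_ofNat 2, ← ENNReal.ofReal_mul (by norm_num),
          ← ENNReal.ofReal_mul (by positivity), ← ENNReal.ofReal_pow (abs_nonneg _),
          ← ENNReal.ofReal_pow (abs_nonneg _), ← ENNReal.ofReal_add (by positivity) (by positivity)]
        refine ENNReal.ofReal_le_ofReal ?_
        rw [sq_abs, sq_abs, mul_assoc, ← abs_mul]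
        nlinarith [le_abs_self (m x * u x), sq_nonneg (m x)]
    _ ≤ _ := by gcongr; exact hS x

end Kernel

/-! ### Averaged divergences and integration by parts without decay -/

/-- The average of a divergence is bounded pointwise by the `L²` norm of the field, since the
derivative can be moved to the kernel. -/
theorem enorm_average_divergence_sq_le
    {X : EuclideanSpace ℝ (Fin d) → EuclideanSpace ℝ (Fin d)} (hX : ContDiff ℝ 1 X)
    {φ : EuclideanSpace ℝ (Fin d) → ℝ} (hφ : ContDiff ℝ 1 φ) (hφs : HasCompactSupport φ)
    (x : EuclideanSpace ℝ (Fin d)) :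
    ‖∫ y, φ y * divergence X (x - y)‖ₑ ^ 2 ≤
      (∫⁻ y, ‖fderiv ℝ φ y‖ₑ ^ 2) * ∫⁻ y, ‖X y‖ₑ ^ 2 := by
  have hg : ContDiff ℝ 1 fun y => φ (x - y) := hφ.comp (contDiff_const.sub contDiff_id)
  have hgs : HasCompactSupport fun y => φ (x - y) :=
    hφs.comp_homeomorph (Homeomorph.subLeft x)
  have hd : ∀ y, fderiv ℝ (fun y => φ (x - y)) y = -fderiv ℝ φ (x - y) := fun y => by
    have h1 : HasFDerivAt (fun y => x - y)
        (-ContinuousLinearMap.id ℝ (EuclideanSpace ℝ (Fin d))) y :=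
      (hasFDerivAt_id y).const_sub x
    have h2 := ((hφ.differentiable one_ne_zero (x - y)).hasFDerivAt.comp y h1).fderiv
    simpa [Function.comp_def] using h2
  have h1 : ∫ y, φ y * divergence X (x - y) = ∫ y, fderiv ℝ φ (x - y) (X y) := by
    have h2 := integral_mul_divergence hX hg hgs
    simp only [hd, neg_apply, integral_neg, neg_neg] at h2
    rw [← h2, ← integral_sub_left_eq_self _ volume x]
    simp
  have hmφ : Measurable fun y => ‖fderiv ℝ φ (x - y)‖ₑ :=
    ((measurable_fderiv ℝ φ).comp (measurable_id.const_sub x)).enorm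
  have hle : ‖∫ y, φ y * divergence X (x - y)‖ₑ ≤ ∫⁻ y, ‖fderiv ℝ φ (x - y)‖ₑ * ‖X y‖ₑ := by
    rw [h1]
    refine (enorm_integral_le_lintegral_enorm _).trans (lintegral_mono fun y => ?_)
    exact ContinuousLinearMap.le_opENorm _ _
  calc _ ≤ _ := pow_le_pow_left' hle 2
    _ ≤ _ := sq_lintegral_mul_le volume hmφ.aemeasurable hX.continuous.measurable.enorm.aemeasurable
    _ = _ := by rw [lintegral_sub_left_eq_self (fun y => ‖fderiv ℝ φ y‖ₑ ^ 2)]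

/-- `∫ X · ∇u ≤ ∫ |div X| |u|` for a bounded field and an integrable function. The cutoff error is at
most `(L / R) ∫ |u|`, so neither decay nor integrability of `X` or `div X` is required. -/
theorem lintegral_inner_le_of_divergence
    {X : EuclideanSpace ℝ (Fin d) → EuclideanSpace ℝ (Fin d)} (hX : ContDiff ℝ 1 X)
    (hX1 : ∀ x, ‖X x‖ ≤ 1) {u : EuclideanSpace ℝ (Fin d) → ℝ} (hu : ContDiff ℝ 1 u)
    (hu1 : ∫⁻ x, ‖u x‖ₑ < ∞) (hpos : ∀ x, 0 ≤ fderiv ℝ u x (X x)) :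
    ∫⁻ x, ENNReal.ofReal (fderiv ℝ u x (X x)) ≤ ∫⁻ x, ‖divergence X x‖ₑ * ‖u x‖ₑ := by
  obtain ⟨L, hL0, hL⟩ := exists_cutoff (EuclideanSpace ℝ (Fin d))
  have hp : Continuous fun x => fderiv ℝ u x (X x) :=
    (hu.continuous_fderiv one_ne_zero).clm_apply hX.continuous
  have hball : ∀ R : ℝ, 0 < R →
      ∫⁻ x in Metric.closedBall 0 R, ENNReal.ofReal (fderiv ℝ u x (X x)) ≤
        (∫⁻ x, ‖divergence X x‖ₑ * ‖u x‖ₑ) + ENNReal.ofReal (L / R) * ∫⁻ x, ‖u x‖ₑ := by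
    intro R hR
    obtain ⟨η, hη, hηs, hη0, hη1, hηR, hηL⟩ := hL R hR
    have hηp : Continuous fun x => fderiv ℝ η x (X x) :=
      (hη.continuous_fderiv one_ne_zero).clm_apply hX.continuous
    have hi1 : Integrable fun x => η x * fderiv ℝ u x (X x) :=
      (hη.continuous.mul hp).integrable_of_hasCompactSupport hηs.mul_right
    have hi2 : Integrable fun x => u x * fderiv ℝ η x (X x) := by
      refine (hu.continuous.mul hηp).integrable_of_hasCompactSupport (HasCompactSupport.mul_left ?_)
      exact (hηs.fderiv ℝ).mono fun x hx hc => hx (by simp [hc])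
    have hd : ∀ x, fderiv ℝ (fun x => u x * η x) x (X x) =
        η x * fderiv ℝ u x (X x) + u x * fderiv ℝ η x (X x) := fun x => by
      rw [fderiv_fun_mul (hu.differentiable one_ne_zero x) (hη.differentiable one_ne_zero x)]
      simp [add_comm]
    have key : ∫ x, η x * fderiv ℝ u x (X x) =
        -(∫ x, u x * η x * divergence X x) - ∫ x, u x * fderiv ℝ η x (X x) := by
      have h1 := integral_mul_divergence hX (hu.mul hη) hηs.mul_left
      simp only [hd] at h1
      rw [integral_add hi1 hi2] at h1
      linarith
    calc _ ≤ ∫⁻ x in Metric.closedBall 0 R, ENNReal.ofReal (η x * fderiv ℝ u x (X x)) := by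
          refine setLIntegral_mono' Metric.isClosed_closedBall.measurableSet fun x hx => ?_
          rw [hηR x (mem_closedBall_zero_iff.1 hx), one_mul]
      _ ≤ ∫⁻ x, ENNReal.ofReal (η x * fderiv ℝ u x (X x)) := setLIntegral_le_lintegral _ _
      _ = ENNReal.ofReal (∫ x, η x * fderiv ℝ u x (X x)) :=
          (ofReal_integral_eq_lintegral_ofReal hi1
            (Filter.Eventually.of_forall fun x => mul_nonneg (hη0 x) (hpos x))).symm
      _ ≤ ‖-(∫ x, u x * η x * divergence X x) - ∫ x, u x * fderiv ℝ η x (X x)‖ₑ := by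
          rw [key, Real.enorm_eq_ofReal_abs]
          exact ENNReal.ofReal_le_ofReal (le_abs_self _)
      _ ≤ ‖∫ x, u x * η x * divergence X x‖ₑ + ‖∫ x, u x * fderiv ℝ η x (X x)‖ₑ := by
          simpa using enorm_sub_le (a := -(∫ x, u x * η x * divergence X x))
            (b := ∫ x, u x * fderiv ℝ η x (X x))
      _ ≤ _ := by
          rw [← lintegral_const_mul' _ _ (by simp)]
          refine add_le_add ((enorm_integral_le_lintegral_enorm _).trans (lintegral_mono fun x => ?_))
            ((enorm_integral_le_lintegral_enorm _).trans (lintegral_mono fun x => ?_))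
          · rw [enorm_mul, enorm_mul, mul_comm]
            gcongr
            refine mul_le_of_le_one_right' ?_
            rw [Real.enorm_of_nonneg (hη0 x)]
            simpa using hη1 x
          · rw [enorm_mul, mul_comm]
            gcongr
            rw [← ofReal_norm]
            refine ENNReal.ofReal_le_ofReal ((ContinuousLinearMap.le_opNorm _ _).trans ?_)
            exact (mul_le_of_le_one_right (norm_nonneg _) (hX1 x)).trans (hηL x)
  have ht1 := (aecover_closedBall (μ := volume) (x := (0 : EuclideanSpace ℝ (Fin d)))
    tendsto_natCast_atTop_atTop).lintegral_tendsto_of_countably_generated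
    (hp.measurable.ennreal_ofReal).aemeasurable
  have ht2 : Filter.Tendsto (fun n : ℕ => (∫⁻ x, ‖divergence X x‖ₑ * ‖u x‖ₑ) +
      ENNReal.ofReal (L / n) * ∫⁻ x, ‖u x‖ₑ) Filter.atTop
      (nhds (∫⁻ x, ‖divergence X x‖ₑ * ‖u x‖ₑ)) := by
    have h1 := ENNReal.Tendsto.mul_const
      (ENNReal.tendsto_ofReal (tendsto_const_div_atTop_nhds_zero_nat L)) (Or.inr hu1.ne)
    simpa using h1.const_add (∫⁻ x, ‖divergence X x‖ₑ * ‖u x‖ₑ)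
  refine le_of_tendsto_of_tendsto ht1 ht2 ?_
  filter_upwards [Filter.eventually_gt_atTop 0] with n hn
  exact hball n (by exact_mod_cast hn)

/-! ### The interpolation inequality -/

variable {h : EuclideanSpace ℝ (Fin d) → ℝ}

theorem excessEnergy_le_lintegral_meanCurvature_mul (hh : ContDiff ℝ 2 h)
    (hL : ∀ x, ‖gradient h x‖ ≤ 1) (hV : ∫⁻ x, ‖h x‖ₑ < ∞) :
    excessEnergy h ≤ ∫⁻ x, ‖meanCurvature h x‖ₑ * ‖h x‖ₑ := by
  have hpt := areaElement_sub_one_le_inner (h := h)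
  rw [excessEnergy_eq hh.continuous]
  calc _ ≤ ∫⁻ x, ENNReal.ofReal (fderiv ℝ h x (slopeField h x)) :=
        lintegral_mono fun x => ENNReal.ofReal_le_ofReal (hpt x)
    _ ≤ _ := lintegral_inner_le_of_divergence (contDiff_slopeField hh)
        (fun x => (norm_slopeField_le x).trans (hL x)) (hh.of_le one_le_two) hV
        fun x => (sub_nonneg.2 (one_le_areaElement x)).trans (hpt x)

theorem lintegral_gradient_sq_le (hh : Continuous h) (hL : ∀ x, ‖gradient h x‖ ≤ 1) :
    ∫⁻ x, ‖gradient h x‖ₑ ^ 2 ≤ 3 * excessEnergy h := by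
  rw [excessEnergy_eq hh, ← lintegral_const_mul' _ _ (by norm_num)]
  refine lintegral_mono fun x => ?_
  rw [← ofReal_norm, ← ENNReal.ofReal_pow (norm_nonneg _), ← ENNReal.ofReal_ofNat 3,
    ← ENNReal.ofReal_mul (by norm_num)]
  exact ENNReal.ofReal_le_ofReal (norm_gradient_sq_le hL x)

theorem excessEnergy_eq_zero_of_excessMass_eq_zero (hh : Continuous h) (hV : excessMass h = 0) :
    excessEnergy h = 0 := by
  rw [excessMass_eq hh, lintegral_eq_zero_iff hh.measurable.enorm] at hV
  have h0 : h = fun _ => 0 := (hh.ae_eq_iff_eq volume continuous_const).1 <| by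
    filter_upwards [hV] with x hx
    simpa using hx
  subst h0
  rw [excessEnergy_eq hh]
  simp [areaElement, gradient]

/-- The interpolation inequality at a fixed length scale `r`, obtained by splitting the curvature
into its average at that scale and the remainder. -/
theorem exists_excessEnergy_le_add_mul (d : ℕ) :
    ∃ C : ℝ, 0 < C ∧ ∀ (h : EuclideanSpace ℝ (Fin d) → ℝ) (f : Ambient d → ℝ),
      ContDiff ℝ 2 h → (∀ x, ‖gradient h x‖ ≤ 1) → excessMass h < ∞ → excessEnergy h < ∞ →
      IsPotential h f → dissipation f < ∞ → ∀ r : ℝ, 0 < r →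
      (excessEnergy h).toReal ≤
        C * (r ^ 3 * (dissipation f).toReal + (excessMass h).toReal ^ 2 / r ^ (d + 2)) := by
  obtain ⟨M, K, hM, hK, hker⟩ := exists_mollifier (EuclideanSpace ℝ (Fin d))
  rw [finrank_euclideanSpace_fin] at hker
  refine ⟨97 + 64 * M + 6 * K, by positivity, fun h f hh hL hV hE hf hD r hr => ?_⟩
  obtain ⟨φ, hφ, hφ0, hφr, hφ1, hφM, hφK⟩ := hker r hr
  have hφs : HasCompactSupport φ := by
    refine HasCompactSupport.of_support_subset_isCompact (isCompact_closedBall 0 r) fun y hy => ?_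
    by_contra hc
    exact hy (hφr y (by simpa using hc))
  set e := (excessEnergy h).toReal
  set v := (excessMass h).toReal
  set δ := (dissipation f).toReal
  have he0 : 0 ≤ e := ENNReal.toReal_nonneg
  have hv0 : 0 ≤ v := ENNReal.toReal_nonneg
  have hδ0 : 0 ≤ δ := ENNReal.toReal_nonneg
  have hEe : excessEnergy h = ENNReal.ofReal e := (ENNReal.ofReal_toReal hE.ne).symm
  have hVv : ∫⁻ x, ‖h x‖ₑ = ENNReal.ofReal v := by
    rw [← excessMass_eq hh.continuous]; exact (ENNReal.ofReal_toReal hV.ne).symm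
  have hDδ : dissipation f = ENNReal.ofReal δ := (ENNReal.ofReal_toReal hD.ne).symm
  have hN : ∫⁻ x, ‖gradient h x‖ₑ ^ 2 ≤ ENNReal.ofReal (3 * e) := by
    refine (lintegral_gradient_sq_le hh.continuous hL).trans_eq ?_
    rw [hEe, ENNReal.ofReal_mul (by norm_num), ENNReal.ofReal_ofNat]
  let H := meanCurvature h
  let Hr := fun x => ∫ y, φ y * H (x - y)
  let m := fun x => ∫ y, φ y * h (x - y)
  have hHc : Continuous H := by
    have : H = f ∘ lift h := funext fun x => (hf.boundary x).symm
    rw [this]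
    exact hf.continuous.comp (continuous_lift hh.continuous)
  have hHrm : Measurable Hr := (stronglyMeasurable_average hHc hφ.continuous).measurable
  have hmm : Measurable m := (stronglyMeasurable_average hh.continuous hφ.continuous).measurable
  -- The remainder of the curvature is controlled by the dissipation.
  have hP : ∫⁻ x, ‖H x - Hr x‖ₑ ^ 2 ≤ ENNReal.ofReal (16 * r * δ) := by
    refine lintegral_enorm_sub_average_sq_le hHc hφ.continuous hφ0 hφr hφ1 fun y hy => ?_
    refine (lintegral_meanCurvature_sub_translate_sq_le hh hL hf hr hy).trans_eq ?_
    rw [hDδ, ENNReal.ofReal_mul (by positivity), ENNReal.ofReal_mul (by norm_num),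
      ENNReal.ofReal_ofNat]
  -- The averaged curvature is bounded, since `H` is a divergence.
  have hS : ∀ x, ‖Hr x‖ₑ ≤ ENNReal.ofReal (√(K / r ^ (d + 2) * (3 * e))) := fun x => by
    refine (ENNReal.pow_le_pow_left_iff two_ne_zero).1 ?_
    rw [← ENNReal.ofReal_pow (Real.sqrt_nonneg _), Real.sq_sqrt (by positivity),
      ENNReal.ofReal_mul (by positivity)]
    refine (enorm_average_divergence_sq_le (contDiff_slopeField hh) hφ hφs x).trans
      (mul_le_mul' hφK (le_trans (lintegral_mono fun y => ?_) hN))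
    gcongr
    rw [← ofReal_norm, ← ofReal_norm]
    exact ENNReal.ofReal_le_ofReal (norm_slopeField_le y)
  have hQ : ∫⁻ x, ‖h x‖ₑ ^ 2 ≤
      ENNReal.ofReal (r ^ 2 * (3 * e) + 2 * (M / r ^ d * v) * v) := by
    have h1 : ∫⁻ x, ‖h x - m x‖ₑ ^ 2 ≤ ENNReal.ofReal (r ^ 2 * (3 * e)) := by
      refine lintegral_enorm_sub_average_sq_le hh.continuous hφ.continuous hφ0 hφr hφ1
        fun y hy => ?_
      refine (lintegral_enorm_sub_translate_sq_le (hh.of_le one_le_two) y).trans ?_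
      rw [ENNReal.ofReal_mul (by positivity), ENNReal.ofReal_pow hr.le]
      gcongr
      rw [← ofReal_norm]
      exact ENNReal.ofReal_le_ofReal hy
    have h2 := lintegral_enorm_sq_le_of_close hh.continuous hmm
      (enorm_average_le (u := h) hφ0 hφM)
    refine h2.trans ?_
    have h3 : ENNReal.ofReal (2 * (M / r ^ d * v) * v) =
        2 * (ENNReal.ofReal (M / r ^ d) * ENNReal.ofReal v) * ENNReal.ofReal v := by
      rw [ENNReal.ofReal_mul (by positivity), ENNReal.ofReal_mul (by norm_num),
        ENNReal.ofReal_mul (by positivity), ENNReal.ofReal_ofNat]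
    rw [hVv, ENNReal.ofReal_add (by positivity) (by positivity), h3]
    gcongr
  set s := √(K / r ^ (d + 2) * (3 * e))
  have hTm : Measurable fun x => ‖H x - Hr x‖ₑ := (hHc.measurable.sub hHrm).enorm
  have hhm : Measurable fun x => ‖h x‖ₑ := hh.continuous.measurable.enorm
  have hT2 := (sq_lintegral_mul_le volume hTm.aemeasurable hhm.aemeasurable).trans
    (mul_le_mul' hP hQ)
  rw [← ENNReal.ofReal_mul (by positivity)] at hT2
  set T := ∫⁻ x, ‖H x - Hr x‖ₑ * ‖h x‖ₑ
  have hTfin : T ≠ ∞ := fun hc => by simp [hc] at hT2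
  obtain ⟨t, ht0, htT⟩ : ∃ t : ℝ, 0 ≤ t ∧ T = ENNReal.ofReal t :=
    ⟨T.toReal, ENNReal.toReal_nonneg, (ENNReal.ofReal_toReal hTfin).symm⟩
  have ht2 : t ^ 2 ≤ 16 * r * δ * (r ^ 2 * (3 * e) + 2 * (M / r ^ d * v) * v) := by
    rw [htT, ← ENNReal.ofReal_pow ht0] at hT2
    exact (ENNReal.ofReal_le_ofReal_iff (by positivity)).1 hT2
  have hle : e ≤ t + s * v := by
    have h1 : excessEnergy h ≤ T + ENNReal.ofReal s * ∫⁻ x, ‖h x‖ₑ := by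
      refine (excessEnergy_le_lintegral_meanCurvature_mul hh hL (hVv ▸ ENNReal.ofReal_lt_top)).trans
        ?_
      rw [← lintegral_const_mul _ hhm, ← lintegral_add_left
        (show Measurable fun x => ‖H x - Hr x‖ₑ * ‖h x‖ₑ from hTm.mul hhm)]
      refine lintegral_mono fun x => ?_
      have h2 : ‖H x‖ₑ ≤ ‖H x - Hr x‖ₑ + ENNReal.ofReal s := by
        calc ‖H x‖ₑ = ‖(H x - Hr x) + Hr x‖ₑ := by rw [sub_add_cancel]
          _ ≤ _ := (enorm_add_le _ _).trans (add_le_add_right (hS x) _)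
      calc _ ≤ (‖H x - Hr x‖ₑ + ENNReal.ofReal s) * ‖h x‖ₑ := mul_le_mul_left h2 _
        _ = _ := add_mul _ _ _
    rw [hEe, htT, hVv, ← ENNReal.ofReal_mul (Real.sqrt_nonneg _),
      ← ENNReal.ofReal_add ht0 (mul_nonneg (Real.sqrt_nonneg _) hv0)] at h1
    exact (ENNReal.ofReal_le_ofReal_iff
      (add_nonneg ht0 (mul_nonneg (Real.sqrt_nonneg _) hv0))).1 h1
  have hs2 : (s * v) ^ 2 = 3 * K * e * (v ^ 2 / r ^ (d + 2)) := by
    rw [mul_pow, Real.sq_sqrt (by positivity)]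
    ring
  have hq0 : 0 ≤ r ^ 3 * δ := by positivity
  have hb0 : 0 ≤ v ^ 2 / r ^ (d + 2) := by positivity
  have ht2' : t ^ 2 ≤ 48 * (r ^ 3 * δ) * e + 32 * M * (r ^ 3 * δ) * (v ^ 2 / r ^ (d + 2)) := by
    refine ht2.trans_eq ?_
    field_simp
    ring
  set q := r ^ 3 * δ
  set b := v ^ 2 / r ^ (d + 2)
  have he2 : e ^ 2 ≤ 2 * t ^ 2 + 2 * (s * v) ^ 2 := by
    nlinarith [sq_nonneg (t - s * v), mul_nonneg (Real.sqrt_nonneg (K / r ^ (d + 2) * (3 * e))) hv0]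
  have he3 : e ^ 2 ≤ (96 + 64 * M + 6 * K) * ((q + b) * e + (q + b) ^ 2) := by
    have a1 : 0 ≤ q * e := by positivity
    have a2 : 0 ≤ b * e := by positivity
    have a3 : 0 ≤ q * b := by positivity
    nlinarith [mul_nonneg hM a1, mul_nonneg hM a2, mul_nonneg hM a3, mul_nonneg hK a1,
      mul_nonneg hK a2, mul_nonneg hK a3, mul_nonneg hM (sq_nonneg q), mul_nonneg hM (sq_nonneg b),
      mul_nonneg hK (sq_nonneg q), mul_nonneg hK (sq_nonneg b), sq_nonneg q, sq_nonneg b]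
  -- `e² ≤ c (S e + S²)` forces `e ≤ (c + 1) S`.
  by_contra! hc
  have hqb : 0 ≤ q + b := by positivity
  have hc0 : 0 ≤ M + K := by positivity
  have he4 : 0 < e := lt_of_le_of_lt (by positivity) hc
  have h5 : (97 + 64 * M + 6 * K) * (q + b) * e < e * e := mul_lt_mul_of_pos_right hc he4
  have h6 : (96 + 64 * M + 6 * K) * (q + b) ^ 2 ≤ (q + b) * e := by
    have : (96 + 64 * M + 6 * K) * (q + b) ≤ e := by nlinarith
    calc _ = (q + b) * ((96 + 64 * M + 6 * K) * (q + b)) := by ring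
      _ ≤ _ := mul_le_mul_of_nonneg_left this hqb
  nlinarith

/-- Optimizing the length scale. The scale at which the two terms balance is `r = (v² / δ) ^ (1 / (d + 5))`. -/
theorem le_rpow_mul_rpow_of_forall_scale {e v δ C : ℝ} (hv : 0 < v) (hδ : 0 < δ)
    (hr : ∀ r : ℝ, 0 < r → e ≤ C * (r ^ 3 * δ + v ^ 2 / r ^ (d + 2))) :
    e ≤ 2 * C * v ^ (6 / ((d : ℝ) + 5)) * δ ^ (((d : ℝ) + 2) / ((d : ℝ) + 5)) := by
  have hd : (0 : ℝ) < (d : ℝ) + 5 := by positivity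
  have h1 := hr (v ^ (2 / ((d : ℝ) + 5)) * δ ^ (-1 / ((d : ℝ) + 5))) (by positivity)
  have e1 : (v ^ (2 / ((d : ℝ) + 5)) * δ ^ (-1 / ((d : ℝ) + 5))) ^ 3 * δ =
      v ^ (6 / ((d : ℝ) + 5)) * δ ^ (((d : ℝ) + 2) / ((d : ℝ) + 5)) := by
    rw [mul_pow, ← Real.rpow_mul_natCast hv.le, ← Real.rpow_mul_natCast hδ.le, mul_assoc]
    rw [← Real.rpow_add_one hδ.ne']
    congr 2
    · push_cast; ring
    · push_cast; field_simp; ring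
  have e2 : v ^ 2 / (v ^ (2 / ((d : ℝ) + 5)) * δ ^ (-1 / ((d : ℝ) + 5))) ^ (d + 2) =
      v ^ (6 / ((d : ℝ) + 5)) * δ ^ (((d : ℝ) + 2) / ((d : ℝ) + 5)) := by
    rw [mul_pow, ← Real.rpow_mul_natCast hv.le, ← Real.rpow_mul_natCast hδ.le, div_mul_eq_div_div,
      ← Real.rpow_natCast v 2, ← Real.rpow_sub hv, div_eq_mul_inv, ← Real.rpow_neg hδ.le]
    congr 2
    · push_cast; field_simp; ring
    · push_cast; field_simp
  rw [e1, e2] at h1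
  linarith

end MullinsSekerka

open MullinsSekerka Filter Topology in
theorem proposition4 (d : ℕ) (hd : 1 ≤ d) :
    ∃ C : ℝ≥0, ∀ (h : EuclideanSpace ℝ (Fin d) → ℝ) (f : MullinsSekerka.Ambient d → ℝ),
      ContDiff ℝ 2 h →
      (∀ x, ‖gradient h x‖ ≤ 1) →
      MullinsSekerka.excessMass h < ∞ →
      MullinsSekerka.excessEnergy h < ∞ →
      MullinsSekerka.IsPotential h f →
      MullinsSekerka.excessEnergy h ≤
        C * MullinsSekerka.excessMass h ^ (6 / ((d : ℝ) + 5)) *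
          MullinsSekerka.dissipation f ^ (((d : ℝ) + 2) / ((d : ℝ) + 5)) := by
  obtain ⟨C, hC, hmain⟩ := exists_excessEnergy_le_add_mul d
  have ha : (0 : ℝ) < 6 / ((d : ℝ) + 5) := by positivity
  have hb : (0 : ℝ) < ((d : ℝ) + 2) / ((d : ℝ) + 5) := by positivity
  refine ⟨(2 * C).toNNReal, fun h f hh hL hV hE hf => ?_⟩
  by_cases hD : dissipation f < ∞
  · have hr := hmain h f hh hL hV hE hf hD
    set e := (excessEnergy h).toReal
    set v := (excessMass h).toReal
    set δ := (dissipation f).toReal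
    have hv0 : 0 ≤ v := ENNReal.toReal_nonneg
    have hδ0 : 0 ≤ δ := ENNReal.toReal_nonneg
    -- The optimal scale degenerates when `v` or `δ` vanishes; both are perturbed by `ε`.
    have hε : ∀ ε : ℝ, 0 < ε → e ≤ 2 * C * (v + ε) ^ (6 / ((d : ℝ) + 5)) *
        (δ + ε) ^ (((d : ℝ) + 2) / ((d : ℝ) + 5)) := fun ε hε =>
      le_rpow_mul_rpow_of_forall_scale (by positivity) (by positivity) fun r hr0 =>
        (hr r hr0).trans (by gcongr <;> linarith)
    have hcont : Continuous fun ε : ℝ => 2 * C * (v + ε) ^ (6 / ((d : ℝ) + 5)) *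
        (δ + ε) ^ (((d : ℝ) + 2) / ((d : ℝ) + 5)) :=
      (continuous_const.mul ((Real.continuous_rpow_const ha.le).comp (by fun_prop))).mul
        ((Real.continuous_rpow_const hb.le).comp (by fun_prop))
    have hlim := (hcont.tendsto 0).mono_left (nhdsWithin_le_nhds (s := Set.Ioi 0))
    simp only [add_zero] at hlim
    have hfin := ge_of_tendsto hlim (eventually_mem_nhdsWithin.mono fun ε => hε ε)
    rw [← ENNReal.ofReal_toReal hE.ne, ← ENNReal.ofReal_toReal hV.ne,
      ← ENNReal.ofReal_toReal hD.ne, ENNReal.ofReal_rpow_of_nonneg hv0 ha.le,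
      ENNReal.ofReal_rpow_of_nonneg hδ0 hb.le, ← ENNReal.ofReal,
      ← ENNReal.ofReal_mul (by positivity), ← ENNReal.ofReal_mul (by positivity)]
    exact ENNReal.ofReal_le_ofReal hfin
  · have hD' : dissipation f = ∞ := not_lt_top_iff.1 hD
    rcases eq_or_ne (excessMass h) 0 with h0 | h0
    · rw [excessEnergy_eq_zero_of_excessMass_eq_zero hh.continuous h0]
      exact zero_le
    · rw [hD', ENNReal.top_rpow_of_pos hb, ENNReal.mul_top]
      · exact le_top
      · refine mul_ne_zero ?_ (by simp [ENNReal.rpow_eq_zero_iff, h0, hV.ne])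
        simpa using hC
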